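/- **Index coding.** An instance $\mathcal I(X,R)$ of the index coding problem consists of a finite set $X$ of messages and a set $R$ of clients $(x,H)$ with $x\in X$ and $H\subseteq X\setminus\{x\}$; the client $(x,H)$ demands $x$ and knows the messages in $H$. Let $\Sigma$ be an alphabet of size $q$ and let every message take values in $\Sigma^n$. An $(n,q)$ index code of length $c$ is a function $f:\Sigma^{n|X|}\to\Sigma^c$ such that for each client $\rho=(x,H)\in R$ there is a decoding function $\psi_\rho:\Sigma^{c+n|H|}\to\Sigma^n$ with $\psi_\rho\bigl(f(\xi),(\xi_h)_{h\in H}\bigr)=\xi_x$ for all $\xi\in\Sigma^{n|X|}$. It is linear if $\Sigma=\mathbb F_q$ and $f$ and all $\psi_\rho$ are $\mathbb F_q$-linear. Let $\lambda(n,q)$ be $\frac1n$ times the smallest length of an $(n,q)$ index code, let $\lambda^*(n,q)$ be $\frac1n$ times the smallest length of a linear one over $\mathbb F_q$, and let $\mu(\mathcal I)=\max_{Y\subseteq X}|\{x:(x,Y)\in R\}|$. **From networks to instances.** A coding network $\mathcal N$ is a finite directed acyclic graph with edge set $E\subseteq V\times V$ together with a surjection $\delta:D\to S$, where $S$ is the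 set of edges whose tail has in-degree $0$ (input edges, one message $x_s$ for each $s\in S$) and $D$ is the set of edges whose head has out-degree $0$ (output edges). Let $\mathcal P(e)$ be the set of edges that end at the tail of $e$. The instance $\mathcal I_{\mathcal N}$ has the messages $y_e$ ($e\in E$) and $x_s$ ($s\in S$), and the clients $(x_s,\{y_s\})$ and $(y_s,\{x_s\})$ for $s\in S$; $(y_e,\{y_{e'}:e'\in\mathcal P(e)\})$ for $e\in E\setminus S$; $(x_{\delta(e)},\{y_e\})$ for $e\in D$; and $(y_e,\{x_s:s\in S\})$ for $e\in E$. **The network $\mathcal N_3$ (Dougherty, Freiling, Zeger).** There are five messages $a,b,c,d,e$. The input edge of each message ends at a node from which the message can be forwarded. There are twelve coding edges, each leaving a node of its own, which receives what is listed in parentheses (a message, or the symbol of another coding edge): $w(a,b)$, $x(b,c)$, $y(a,x)$, $z(w,x)$; $p_{abc}(a,b,c)$, $p_{ab}(a,b)$, $p_{ac}(a,c)$, $p_{bc}(b,c)$; $q_{cde}(c,d,e)$, $q_{de}(d,e)$, $q_{cd}(c,d)$, $q_{ce}(c,e)$. There are ten receivers, each with one output edge that carries the demanded message; written as (received) $\to$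 demanded, they are $(w,y)\to c$, $(y,z)\to b$, $(z,c)\to a$; $(p_{abc},p_{ab})\to c$, $(p_{abc},p_{ac})\to b$, $(p_{abc},p_{bc})\to a$; $(q_{cde},q_{de})\to c$, $(q_{cde},q_{cd})\to e$, $(q_{cde},q_{ce})\to d$; and $(p_{ab},p_{ac},p_{bc},q_{de},q_{cd},q_{ce})\to c$. Every listed reception is a separate edge of unit capacity. **Corollary.** For the instance $\mathcal I_{\mathcal N_3}$ of the index coding problem, $$\lambda(2,4)=\mu(\mathcal I_{\mathcal N_3})<\lambda^*(2,4).$$ In particular, on this instance non-linear $(2,4)$ index codes achieve a strictly smaller rate than linear index codes of block length $2$ over $\mathbb F_4$. -/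

import Mathlib

namespace IndexCoding

/-! ### Index coding -/

/-- An instance of the index coding problem with message set `X`: a set of clients `(x, H)`,
where `x` is the demanded message and `H` (not containing `x`) is the side information. -/
structure Instance (X : Type*) where
  clients : Set (X × Set X)
  demand_notMem : ∀ ρ ∈ clients, ρ.1 ∉ ρ.2

namespace Instance

variable {X : Type*} (I : Instance X)

/-- `f` is an index code over the alphabet `A`, of block length `n` and length `c`: every client
recovers its message from the broadcast word and its side information. -/
def IsIndexCode (A : Type*) (n c : ℕ) (f : (X → Fin n → A) → (Fin c → A)) : Prop :=
  ∀ ρ ∈ I.clients, ∃ ψ : (Fin c → A) → (ρ.2 → Fin n → A) → (Fin n → A),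
    ∀ ξ : X → Fin n → A, ψ (f ξ) (fun h => ξ h) = ξ ρ.1

/-- `f` is a linear index code over the field `F`, of block length `n` and length `c`: the encoding
and all decoding functions are linear. -/
def IsLinearIndexCode (F : Type*) [Field F] (n c : ℕ)
    (f : (X → Fin n → F) →ₗ[F] (Fin c → F)) : Prop :=
  ∀ ρ ∈ I.clients, ∃ ψ : ((Fin c → F) × (ρ.2 → Fin n → F)) →ₗ[F] (Fin n → F),
    ∀ ξ : X → Fin n → F, ψ (f ξ, fun h => ξ h) = ξ ρ.1

/-- The smallest length of an index code of block length `n` over an alphabet of size `q`. -/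
noncomputable def minLength (n q : ℕ) : ℕ :=
  sInf {c | ∃ f, I.IsIndexCode (Fin q) n c f}

/-- The smallest length of a linear index code of block length `n` over the field `F`. -/
noncomputable def minLinearLength (n : ℕ) (F : Type*) [Field F] : ℕ :=
  sInf {c | ∃ f, I.IsLinearIndexCode F n c f}

/-- The optimal transmission rate `λ(n, q)`. -/
noncomputable def rate (n q : ℕ) : ℚ := (I.minLength n q : ℚ) / n

/-- The optimal vector linear transmission rate `λ*(n, q)`, where `F` is the field of `q`
elements. -/
noncomputable def linearRate (n : ℕ) (F : Type*) [Field F] : ℚ := (I.minLinearLength n F : ℚ) / n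

/-- The maximal number `μ` of messages requested by clients with identical side information. -/
noncomputable def mu [Finite X] : ℕ :=
  ⨆ Y : Set X, {x : X | (x, Y) ∈ I.clients}.ncard

end Instance

/-! ### Coding networks -/

section Network

variable {V : Type*}

/-- Edges whose tail node has no incoming edge. -/
def inputEdges (E : Set (V × V)) : Set (V × V) :=
  {e | e ∈ E ∧ ∀ e' ∈ E, e'.2 ≠ e.1}

/-- Edges whose head node has no outgoing edge. -/
def outputEdges (E : Set (V × V)) : Set (V × V) :=
  {e | e ∈ E ∧ ∀ e' ∈ E, e'.1 ≠ e.2}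

end Network

/-- A coding network: a finite directed acyclic graph, together with a demand function `δ` from the
output edges onto the input edges. There is one message for each input edge. -/
structure CodingNetwork (V : Type*) [Finite V] where
  E : Set (V × V)
  acyclic : ∀ v, ¬ Relation.TransGen (fun u w => (u, w) ∈ E) v v
  δ : outputEdges E → inputEdges E
  δ_surjective : Function.Surjective δ

namespace CodingNetwork

variable {V : Type*} [Finite V] (N : CodingNetwork V)

/-- The messages of the index coding instance of a network: a message `y e` for each edge and a
message `x s` for each input edge. -/
abbrev Message : Type _ := N.E ⊕ inputEdges N.E

/-- The message of an edge. -/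
abbrev y (e : N.E) : N.Message := Sum.inl e

/-- The message of an input edge that comes from the network. -/
abbrev x (s : inputEdges N.E) : N.Message := Sum.inr s

/-- The parent edges of an edge: those whose head is its tail. -/
def parents (e : N.E) : Set N.E := {e' | e'.1.2 = e.1.1}

/-- An input edge, as an edge. -/
def ofInput (s : inputEdges N.E) : N.E := ⟨s.1, s.2.1⟩

/-- An output edge, as an edge. -/
def ofOutput (t : outputEdges N.E) : N.E := ⟨t.1, t.2.1⟩

/-- The clients of the index coding instance of a network. -/
inductive IsClient : N.Message × Set N.Message → Prop
  | r₁ (s : inputEdges N.E) : IsClient (N.x s, {N.y (N.ofInput s)})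
  | r₂ (s : inputEdges N.E) : IsClient (N.y (N.ofInput s), {N.x s})
  | r₃ (e : N.E) (he : e.1 ∉ inputEdges N.E) : IsClient (N.y e, N.y '' N.parents e)
  | r₄ (t : outputEdges N.E) : IsClient (N.x (N.δ t), {N.y (N.ofOutput t)})
  | r₅ (e : N.E) : IsClient (N.y e, Set.range N.x)

/-- The index coding instance of a network. -/
def indexInstance : Instance N.Message where
  clients := {ρ | N.IsClient ρ}
  demand_notMem := by
    rintro _ (s | s | ⟨e, he⟩ | t | e)
    · simp
    · simp
    · rintro ⟨e', h, h'⟩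
      obtain rfl : e' = e := Sum.inl_injective h'
      refine N.acyclic e'.1.1 (.single ?_)
      have h' := e'.2
      rwa [show e'.1 = (e'.1.1, e'.1.1) from Prod.ext rfl h] at h'
    · simp
    · simp

end CodingNetwork

/-! ### The Dougherty–Freiling–Zeger network

Five messages `a, b, c, d, e`. The network consists of two parts which have only the sources in
common: a part of Fano type on `a, b, c`, and a part of non-Fano type with two blocks, on `a, b, c`
and on `c, d, e`, which share one last receiver. -/

namespace DFZ

inductive Msg
  | a | b | c | d | e
  deriving DecidableEq

instance : Fintype Msg where
  elems := {.a, .b, .c, .d, .e}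
  complete i := by cases i <;> decide

/-- The twelve coding edges (bottlenecks). `w, x, y, z` belong to the Fano part, the `p`'s to
the first and the `q`'s to the second block of the non-Fano part. -/
inductive Coder
  | w | x | y | z
  | pabc | pab | pac | pbc
  | qcde | qde | qcd | qce
  deriving DecidableEq

instance : Fintype Coder where
  elems := {.w, .x, .y, .z, .pabc, .pab, .pac, .pbc, .qcde, .qde, .qcd, .qce}
  complete i := by cases i <;> decide

/-- The ten receivers: three in the Fano part, three in each block of the non-Fano part, and the
last one. -/
inductive Receiver
  | f₁ | f₂ | f₃
  | p₁ | p₂ | p₃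
  | q₁ | q₂ | q₃
  | last
  deriving DecidableEq

instance : Fintype Receiver where
  elems := {.f₁, .f₂, .f₃, .p₁, .p₂, .p₃, .q₁, .q₂, .q₃, .last}
  complete i := by cases i <;> decide

/-- The messages that enter a coding edge directly. -/
def Coder.msgs : Coder → Finset Msg
  | .w => {.a, .b}
  | .x => {.b, .c}
  | .y => {.a}
  | .z => ∅
  | .pabc => {.a, .b, .c}
  | .pab => {.a, .b}
  | .pac => {.a, .c}
  | .pbc => {.b, .c}
  | .qcde => {.c, .d, .e}
  | .qde => {.d, .e}
  | .qcd => {.c, .d}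
  | .qce => {.c, .e}

/-- The coding edges that feed a coding edge. -/
def Coder.coders : Coder → Finset Coder
  | .y => {.x}
  | .z => {.w, .x}
  | _ => ∅

/-- The messages that a receiver gets directly. -/
def Receiver.msgs : Receiver → Finset Msg
  | .f₃ => {.c}
  | _ => ∅

/-- The coding edges that feed a receiver. -/
def Receiver.coders : Receiver → Finset Coder
  | .f₁ => {.w, .y}
  | .f₂ => {.y, .z}
  | .f₃ => {.z}
  | .p₁ => {.pabc, .pab}
  | .p₂ => {.pabc, .pac}
  | .p₃ => {.pabc, .pbc}
  | .q₁ => {.qcde, .qde}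
  | .q₂ => {.qcde, .qcd}
  | .q₃ => {.qcde, .qce}
  | .last => {.pab, .pac, .pbc, .qde, .qcd, .qce}

/-- The message demanded by a receiver. -/
def Receiver.demand : Receiver → Msg
  | .f₁ => .c
  | .f₂ => .b
  | .f₃ => .a
  | .p₁ => .c
  | .p₂ => .b
  | .p₃ => .a
  | .q₁ => .c
  | .q₂ => .e
  | .q₃ => .d
  | .last => .c

/-- The nodes. The input edge of message `m` is `src m → hub m`, the coding edge `k` is
`enter k → leave k`, and the output edge of receiver `r` is `rcv r → sink r`. -/
inductive Node
  | src (m : Msg)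
  | hub (m : Msg)
  | enter (k : Coder)
  | leave (k : Coder)
  | rcv (r : Receiver)
  | sink (r : Receiver)
  deriving DecidableEq

instance : Fintype Node where
  elems := Finset.univ.image .src ∪ Finset.univ.image .hub ∪ Finset.univ.image .enter ∪
    Finset.univ.image .leave ∪ Finset.univ.image .rcv ∪ Finset.univ.image .sink
  complete v := by cases v <;> simp

/-- The edges, as a Boolean relation. -/
def adj : Node → Node → Bool
  | .src m, .hub m' => m = m'
  | .hub m, .enter k => m ∈ k.msgs
  | .leave k', .enter k => k' ∈ k.coders
  | .enter k, .leave k' => k = k'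
  | .hub m, .rcv r => m ∈ r.msgs
  | .leave k, .rcv r => k ∈ r.coders
  | .rcv r, .sink r' => r = r'
  | _, _ => false

/-- The set of edges. -/
def edges : Set (Node × Node) := {p | adj p.1 p.2 = true}

theorem mem_edges (u v : Node) : (u, v) ∈ edges ↔ adj u v = true := Iff.rfl

/-- A topological order of the nodes. -/
def level : Node → ℕ
  | .src _ => 0
  | .hub _ => 1
  | .enter k => if k.coders = ∅ then 2 else 4
  | .leave k => if k.coders = ∅ then 3 else 5
  | .rcv _ => 6
  | .sink _ => 7

theorem level_lt {u v : Node} (h : (u, v) ∈ edges) : level u < level v := by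
  rw [mem_edges] at h
  revert h
  cases u <;> cases v <;> rename_i i j <;> first | (simp [adj]; done) | (revert i j; decide)

theorem input_mem (m : Msg) : (Node.src m, Node.hub m) ∈ inputEdges edges := by
  refine ⟨(mem_edges _ _).2 (by simp [adj]), ?_⟩
  intro p h hv
  have h' := (mem_edges p.1 p.2).1 h
  rw [hv] at h'
  cases hu : p.1 <;> simp [adj, hu] at h'

theorem output_mem (r : Receiver) : (Node.rcv r, Node.sink r) ∈ outputEdges edges := by
  refine ⟨(mem_edges _ _).2 (by simp [adj]), ?_⟩
  intro p h hu
  have h' := (mem_edges p.1 p.2).1 h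
  rw [hu] at h'
  cases hv : p.2 <;> simp [adj] at h'

/-- The message demanded at the tail of an output edge. All output edges start at a receiver, so
the value at the other nodes is irrelevant. -/
def demandAt : Node → Msg
  | .rcv r => r.demand
  | _ => .c

/-- The Dougherty–Freiling–Zeger network. -/
def network : CodingNetwork Node where
  E := edges
  acyclic v h := by
    have key : ∀ w, Relation.TransGen (fun u w => (u, w) ∈ edges) v w → level v < level w := by
      intro w hw
      induction hw with
      | single h => exact level_lt h
      | tail _ h ih => exact ih.trans (level_lt h)
    exact lt_irrefl _ (key v h)
  δ t := ⟨(.src (demandAt t.1.1), .hub (demandAt t.1.1)), input_mem _⟩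
  δ_surjective := by
    rintro ⟨⟨u, v⟩, h⟩
    have h1 := (mem_edges u v).1 h.1
    have h2 := h.2
    have hm : ∀ m : Msg, (Node.src m, Node.hub m) ∈ edges := fun m =>
      (mem_edges _ _).2 (by simp [adj])
    have hk : ∀ k : Coder, (Node.enter k, Node.leave k) ∈ edges := fun k =>
      (mem_edges _ _).2 (by simp [adj])
    have hl : ∀ k : Coder, ∃ m, (Node.hub m, Node.enter k) ∈ edges ∨
        ∃ k', (Node.leave k', Node.enter k) ∈ edges := by
      simp only [mem_edges]; decide
    have hr : ∀ r : Receiver, ∃ k, (Node.leave k, Node.rcv r) ∈ edges := by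
      simp only [mem_edges]; decide
    cases u with
    | src m =>
      cases v with
      | hub m' =>
        have : m = m' := by simpa [adj] using h1
        subst this
        have hd : ∀ m : Msg, ∃ r : Receiver, r.demand = m := by decide
        obtain ⟨r, rfl⟩ := hd m
        exact ⟨⟨_, output_mem r⟩, rfl⟩
      | _ => simp [adj] at h1
    | hub m => exact absurd rfl (h2 _ (hm m))
    | enter k =>
      obtain ⟨m, h | ⟨k', h⟩⟩ := hl k
      · exact absurd rfl (h2 _ h)
      · exact absurd rfl (h2 _ h)
    | leave k => exact absurd rfl (h2 _ (hk k))
    | rcv r =>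
      obtain ⟨k, h⟩ := hr r
      exact absurd rfl (h2 _ h)
    | sink r => cases v <;> simp [adj] at h1

end DFZ

end IndexCoding

/-! Both rates are compared with |E|. The clients `r₅` share one side information set and together
demand every `y e`, so by counting at least n|E| symbols are needed. A network code attains this:
broadcast `y e` minus the symbol of the edge `e`; given the broadcast, knowing `y e` amounts to
knowing that symbol (`exists_isIndexCode_of_networkCode`). Conversely, the kernel of a linear index
code of exactly this length is the graph of a linear map from the `x` messages to the `y` messages,
which is a linear network code (`exists_linear_networkCode`).

Over four letters the network has a code: the Fano part uses xor, the non-Fano part addition mod 4.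
The last receiver learns 2c from one block and twice the digit-swapped c from the other, hence both
digits of c. Over a finite field of characteristic two, the pairwise codes of each non-Fano block
can all vanish for any prescribed c (`exists_pairwise_codes_eq_zero`), so the last receiver cannot
tell a nonzero c from zero. Linear codes must therefore be strictly longer. -/

namespace IndexCoding

/-! ### Index codes and the counting bound -/

namespace Instance

variable {X : Type*} (I : Instance X)

/-- A broadcast function is an index code if the demand of every client is determined by the
broadcast word and the side information. -/
theorem isIndexCode_of_determined {A : Type*} [Nonempty A] {n c : ℕ}
    {f : (X → Fin n → A) → (Fin c → A)}
    (h : ∀ ρ ∈ I.clients, ∀ ξ ξ' : X → Fin n → A, f ξ = f ξ' → (∀ i ∈ ρ.2, ξ i = ξ' i) →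
      ξ ρ.1 = ξ' ρ.1) : I.IsIndexCode A n c f := by
  classical
  intro ρ hρ
  let g : (X → Fin n → A) → (Fin c → A) × (ρ.2 → Fin n → A) := fun ξ => (f ξ, fun i => ξ i)
  have hg : Function.FactorsThrough (fun ξ : X → Fin n → A => ξ ρ.1) g := by
    intro ξ ξ' hξ
    exact h ρ hρ ξ ξ' (congrArg Prod.fst hξ)
      fun i hi => congrFun (congrArg Prod.snd hξ) ⟨i, hi⟩
  refine ⟨fun u v => Function.extend g (fun ξ => ξ ρ.1) (fun _ _ => Classical.arbitrary A) (u, v),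
    fun ξ => ?_⟩
  exact hg.extend_apply _ ξ

variable {I}

theorem IsIndexCode.determined {A : Type*} {n c : ℕ} {f : (X → Fin n → A) → (Fin c → A)}
    (hf : I.IsIndexCode A n c f) {ρ : X × Set X} (hρ : ρ ∈ I.clients) {ξ ξ' : X → Fin n → A}
    (h : f ξ = f ξ') (h' : ∀ i ∈ ρ.2, ξ i = ξ' i) : ξ ρ.1 = ξ' ρ.1 := by
  obtain ⟨ψ, hψ⟩ := hf ρ hρ
  rw [← hψ ξ, ← hψ ξ', h]
  congr 1
  funext i
  exact h' i i.2

theorem IsLinearIndexCode.isIndexCode {F : Type*} [Field F] {n c : ℕ}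
    {f : (X → Fin n → F) →ₗ[F] (Fin c → F)} (hf : I.IsLinearIndexCode F n c f) :
    I.IsIndexCode F n c f := by
  intro ρ hρ
  obtain ⟨ψ, hψ⟩ := hf ρ hρ
  exact ⟨fun u v => ψ (u, v), hψ⟩

/-- Clients with the same side information can together demand no more than is broadcast. -/
theorem IsIndexCode.mul_ncard_le [Finite X] {A : Type*} [Finite A] [Nontrivial A] {n c : ℕ}
    {f : (X → Fin n → A) → (Fin c → A)} (hf : I.IsIndexCode A n c f) (Y : Set X) :
    n * {x : X | (x, Y) ∈ I.clients}.ncard ≤ c := by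
  classical
  set T := {x : X | (x, Y) ∈ I.clients}
  obtain ⟨a₀⟩ : Nonempty A := inferInstance
  -- Messages outside `T` get a fixed value. No client demands what it knows, so `Y` is disjoint
  -- from `T` and all these extensions agree on `Y`.
  let ext : (T → Fin n → A) → X → Fin n → A :=
    fun v x => if h : x ∈ T then v ⟨x, h⟩ else fun _ => a₀
  have hinj : Function.Injective (fun v => f (ext v)) := by
    intro v v' hv
    funext x
    have hx : ((x : X), Y) ∈ I.clients := x.2
    have := hf.determined hx hv fun i hi => by
      have hi' : i ∉ T := fun h => I.demand_notMem _ h hi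
      simp [ext, hi']
    simpa [ext, x.2] using this
  have hcard := Nat.card_le_card_of_injective _ hinj
  rw [Nat.card_fun, Nat.card_fun, Nat.card_fun, ← pow_mul] at hcard
  simp only [Nat.card_eq_fintype_card, Fintype.card_fin] at hcard
  rw [Nat.card_coe_set_eq] at hcard
  exact (Nat.pow_le_pow_iff_right Finite.one_lt_card).1 hcard

theorem IsIndexCode.mul_mu_le [Finite X] {A : Type*} [Finite A] [Nontrivial A] {n c : ℕ}
    {f : (X → Fin n → A) → (Fin c → A)} (hf : I.IsIndexCode A n c f) : n * I.mu ≤ c := by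
  obtain ⟨Y, hY⟩ := exists_eq_ciSup_of_finite
    (f := fun Y : Set X => {x : X | (x, Y) ∈ I.clients}.ncard)
  rw [mu, ← hY]
  exact hf.mul_ncard_le Y

variable (I) in
/-- Broadcasting all messages is a linear index code. -/
theorem exists_isLinearIndexCode [Finite X] (F : Type*) [Field F] (n : ℕ) :
    ∃ c, ∃ f, I.IsLinearIndexCode F n c f := by
  let e : Fin (Nat.card (X × Fin n)) ≃ X × Fin n := (Finite.equivFin _).symm
  let L : (X → Fin n → F) ≃ₗ[F] (Fin (Nat.card (X × Fin n)) → F) :=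
    (LinearEquiv.curry F F X (Fin n)).symm.trans (LinearEquiv.funCongrLeft F F e)
  refine ⟨_, L.toLinearMap, fun ρ _ => ?_⟩
  exact ⟨LinearMap.proj ρ.1 ∘ₗ L.symm.toLinearMap ∘ₗ LinearMap.fst _ _ _, fun ξ => by simp⟩

end Instance

/-! ### Network codes versus index codes of length n|E| -/

namespace CodingNetwork

variable {V : Type*} [Finite V] (N : CodingNetwork V)

theorem card_edges_le_mu : Nat.card N.E ≤ N.indexInstance.mu := by
  have hb : BddAbove (Set.range fun Y : Set N.Message =>
      {x : N.Message | (x, Y) ∈ N.indexInstance.clients}.ncard) := (Set.finite_range _).bddAbove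
  refine le_trans ?_ (le_ciSup hb (Set.range N.x))
  rw [← Set.ncard_range_of_injective (f := N.y) Sum.inl_injective]
  refine Set.ncard_le_ncard ?_ (Set.toFinite _)
  rintro _ ⟨e, rfl⟩
  exact IsClient.r₅ e

/-- A network code over an additive group yields an index code whose broadcast consists of one
block for each edge. -/
theorem exists_isIndexCode_of_networkCode {A : Type*} [AddGroup A] (n : ℕ)
    (φ : N.E → (inputEdges N.E → Fin n → A) → Fin n → A)
    (hin : ∀ s v, φ (N.ofInput s) v = v s)
    (hcode : ∀ e : N.E, e.1 ∉ inputEdges N.E → ∀ v v',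
      (∀ e' ∈ N.parents e, φ e' v = φ e' v') → φ e v = φ e v')
    (hout : ∀ t v, φ (N.ofOutput t) v = v (N.δ t)) :
    ∃ f, N.indexInstance.IsIndexCode A n (n * Nat.card N.E) f := by
  have hc : n * Nat.card N.E = Nat.card (N.E × Fin n) := by simp [mul_comm]
  rw [hc]
  let ε : Fin (Nat.card (N.E × Fin n)) ≃ N.E × Fin n := (Finite.equivFin _).symm
  let f : (N.Message → Fin n → A) → Fin (Nat.card (N.E × Fin n)) → A := fun ξ i =>
    ξ (N.y (ε i).1) (ε i).2 - φ (ε i).1 (fun s => ξ (N.x s)) (ε i).2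
  refine ⟨f, N.indexInstance.isIndexCode_of_determined fun ρ hρ ξ ξ' hf h => ?_⟩
  have hdiff : ∀ e, ξ (N.y e) - φ e (fun s => ξ (N.x s)) =
      ξ' (N.y e) - φ e (fun s => ξ' (N.x s)) := by
    intro e
    funext j
    simpa [f] using congrFun hf (ε.symm (e, j))
  have hφ : ∀ e, ξ (N.y e) = ξ' (N.y e) →
      φ e (fun s => ξ (N.x s)) = φ e (fun s => ξ' (N.x s)) := fun e he => by
    have := hdiff e
    rw [he] at this
    exact sub_right_injective this
  have hy : ∀ e, φ e (fun s => ξ (N.x s)) = φ e (fun s => ξ' (N.x s)) →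
      ξ (N.y e) = ξ' (N.y e) := fun e he => by
    have := hdiff e
    rw [he] at this
    exact sub_left_injective this
  obtain s | s | ⟨e, he⟩ | t | e := hρ
  · simpa [hin] using hφ _ (h _ rfl)
  · exact hy _ (by simpa [hin] using h _ rfl)
  · exact hy _ (hcode e he _ _ fun e' he' => hφ _ (h _ ⟨e', he', rfl⟩))
  · simpa [hout] using hφ _ (h _ rfl)
  · refine hy _ (congrArg _ (funext fun s => h _ ⟨s, rfl⟩))

/-- A linear index code with one block for each edge yields a linear network code. Its values `g v`
at the messages `v` have the property that a client whose side information vanishes demands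
zero. -/
theorem exists_linear_networkCode {F : Type*} [Field F] {n : ℕ}
    {f : (N.Message → Fin n → F) →ₗ[F] (Fin (n * Nat.card N.E) → F)}
    (hf : N.indexInstance.IsLinearIndexCode F n _ f) :
    ∃ g : (inputEdges N.E → Fin n → F) →ₗ[F] (N.Message → Fin n → F),
      (∀ v s, g v (N.x s) = v s) ∧
      ∀ v, ∀ ρ, N.IsClient ρ → (∀ i ∈ ρ.2, g v i = 0) → g v ρ.1 = 0 := by
  have := Fintype.ofFinite N.E
  let Φ := (LinearEquiv.sumArrowLequivProdArrow N.E (inputEdges N.E) F (Fin n → F)).symm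
  have hΦy : ∀ u v e, Φ (u, v) (N.y e) = u e := fun u v e => by simp [Φ]
  have hΦx : ∀ u v s, Φ (u, v) (N.x s) = v s := fun u v s => by simp [Φ]
  -- The encoder with all `x` messages zero. The clients `r₅` make it injective, and the length was
  -- chosen so that it is then bijective.
  let L : (N.E → Fin n → F) →ₗ[F] (Fin (n * Nat.card N.E) → F) :=
    f ∘ₗ Φ.toLinearMap ∘ₗ LinearMap.inl F _ _
  have hL : Function.Injective L := by
    intro u u' h
    funext e
    have := hf.isIndexCode.determined (ρ := (N.y e, Set.range N.x)) (IsClient.r₅ e)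
      (ξ := Φ (u, 0)) (ξ' := Φ (u', 0)) h (by rintro _ ⟨s, rfl⟩; rw [hΦx, hΦx])
    simpa only [hΦy] using this
  have hrank : Module.finrank F (N.E → Fin n → F) =
      Module.finrank F (Fin (n * Nat.card N.E) → F) := by
    rw [Module.finrank_fin_fun]
    simp [Module.finrank_pi_fintype, mul_comm]
  let e := LinearEquiv.ofBijective L
    ⟨hL, (LinearMap.injective_iff_surjective_of_finrank_eq_finrank hrank).1 hL⟩
  let M : (inputEdges N.E → Fin n → F) →ₗ[F] (Fin (n * Nat.card N.E) → F) :=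
    f ∘ₗ Φ.toLinearMap ∘ₗ LinearMap.inr F _ _
  -- The unique completion of `v` by `y` messages that makes the broadcast zero.
  let g := Φ.toLinearMap ∘ₗ LinearMap.prod (-(e.symm.toLinearMap ∘ₗ M)) LinearMap.id
  have hfg : ∀ v, f (g v) = 0 := by
    intro v
    have h1 : g v = Φ (-(e.symm (M v)), 0) + Φ (0, v) := by
      rw [← map_add, Prod.mk_add_mk, add_zero, zero_add]
      rfl
    have h2 : f (Φ (-(e.symm (M v)), 0)) = e (-(e.symm (M v))) := rfl
    have h3 : f (Φ (0, v)) = M v := rfl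
    rw [h1, map_add, h2, h3, map_neg, e.apply_symm_apply, neg_add_cancel]
  refine ⟨g, fun v s => hΦx _ _ s, fun v ρ hρ h => ?_⟩
  have := hf.isIndexCode.determined (ρ := ρ) hρ (ξ := g v) (ξ' := 0) (by rw [hfg, map_zero]) h
  exact this

end CodingNetwork

/-! ### Linear algebra of one non-Fano block -/

/-- In characteristic two, the three pairwise codes of a block of non-Fano type do not reveal
anything about `c`: every value of `c` is compatible with all of them being zero. -/
theorem exists_pairwise_codes_eq_zero {V : Type*} [AddCommGroup V] [Finite V]
    (hV : ∀ v : V, v + v = 0) (A B C A₁ B₁ A₂ C₂ B₃ C₃ : V →+ V)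
    (hc : ∀ a b c, A a + B b + C c = 0 → A₁ a + B₁ b = 0 → c = 0)
    (hb : ∀ a b c, A a + B b + C c = 0 → A₂ a + C₂ c = 0 → b = 0)
    (ha : ∀ a b c, A a + B b + C c = 0 → B₃ b + C₃ c = 0 → a = 0) (c : V) :
    ∃ a b, A₁ a + B₁ b = 0 ∧ A₂ a + C₂ c = 0 ∧ B₃ b + C₃ c = 0 := by
  have bij : ∀ f : V →+ V, (∀ v, f v = 0 → v = 0) → Function.Surjective f := fun f h =>
    Finite.surjective_of_injective ((injective_iff_map_eq_zero f).2 h)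
  have hA := bij A fun a h => ha a 0 0 (by simp [h]) (by simp)
  have hB := bij B fun b h => hb 0 b 0 (by simp [h]) (by simp)
  have hC := bij C fun c h => hc 0 0 c (by simp [h]) (by simp)
  have eq_of : ∀ {u v : V}, u + v = 0 → u = v := fun {u v} h => by
    rw [← sub_eq_zero, sub_eq_add_neg, neg_eq_of_add_eq_zero_right (hV v), h]
  have inj : ∀ f : V →+ V, Function.Surjective f → ∀ u v, f u = f v → u = v := fun f h u v huv =>
    Finite.injective_iff_surjective.2 h huv
  -- the pairwise code of two messages vanishes only where the block code does
  have hab : ∀ a b, A₁ a + B₁ b = 0 → A a + B b = 0 := fun a b h => by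
    -- Complete `a`, `b` by some `c'` to a zero of the block code; the decoder of the third message
    -- then forces `c' = 0`.
    obtain ⟨c', hc'⟩ := hC (-(A a + B b))
    have := hc a b c' (by rw [hc']; abel) h
    subst this
    rwa [map_zero, eq_comm, neg_eq_zero] at hc'
  have hac : ∀ a c, A₂ a + C₂ c = 0 → A a + C c = 0 := fun a c h => by
    obtain ⟨b', hb'⟩ := hB (-(A a + C c))
    have := hb a b' c (by rw [hb']; abel) h
    subst this
    rwa [map_zero, eq_comm, neg_eq_zero] at hb'
  have hbc : ∀ b c, B₃ b + C₃ c = 0 → B b + C c = 0 := fun b c h => by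
    obtain ⟨a', ha'⟩ := hA (-(B b + C c))
    have := ha a' b c (by rw [ha']; abel) h
    subst this
    rwa [map_zero, eq_comm, neg_eq_zero] at ha'
  have hA₁ := bij A₁ fun a h => inj A hA _ _ (by simpa using hab a 0 (by simpa using h))
  have hA₂ := bij A₂ fun a h => inj A hA _ _ (by simpa using hac a 0 (by simpa using h))
  have hB₃ := bij B₃ fun b h => inj B hB _ _ (by simpa using hbc b 0 (by simpa using h))
  obtain ⟨a, h₂⟩ := hA₂ (-(C₂ c))
  obtain ⟨b, h₃⟩ := hB₃ (-(C₃ c))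
  obtain ⟨a', h₁⟩ := hA₁ (-(B₁ b))
  have e₂ : A₂ a + C₂ c = 0 := by rw [h₂, neg_add_cancel]
  have e₃ : B₃ b + C₃ c = 0 := by rw [h₃, neg_add_cancel]
  have e₁ : A₁ a' + B₁ b = 0 := by rw [h₁, neg_add_cancel]
  -- The only use of characteristic two: `A a' = B b = C c = A a`. With signs, the same chain would
  -- give `a' = -a`.
  have haa : a' = a := inj A hA _ _ <| (eq_of (hab _ _ e₁)).trans <|
    (eq_of (hbc _ _ e₃)).trans (eq_of (hac _ _ e₂)).symm
  exact ⟨a, b, haa ▸ e₁, e₂, e₃⟩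

/-! ### Input and output edges of the network -/

namespace DFZ

/-- The input edge of a message. -/
def inputEdge (m : Msg) : inputEdges network.E := ⟨(.src m, .hub m), input_mem m⟩

/-- Every input edge is a value of the surjection `δ`, whose values have this form by construction.
-/
theorem inputEdge_surjective : Function.Surjective inputEdge := fun s => by
  obtain ⟨t, rfl⟩ := network.δ_surjective s
  exact ⟨_, rfl⟩

/-- The output edge of a receiver. -/
def outputEdge (r : Receiver) : outputEdges network.E := ⟨(.rcv r, .sink r), output_mem r⟩

theorem outputEdge_surjective : Function.Surjective outputEdge := by
  rintro ⟨⟨u, v⟩, h⟩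
  have h1 := (mem_edges u v).1 h.1
  have h2 : ∀ w, adj v w ≠ true := fun w hw => h.2 (v, w) hw rfl
  have hm : ∀ m : Msg, ∃ k : Coder, m ∈ k.msgs := by decide
  have hk : ∀ k : Coder, ∃ r : Receiver, (∃ k', k ∈ Coder.coders k') ∨ k ∈ r.coders := by decide
  cases v with
  | src m => exact absurd (by simp [adj]) (h2 (.hub m))
  | hub m =>
    obtain ⟨k, hk⟩ := hm m
    exact absurd (by simpa [adj] using hk) (h2 (.enter k))
  | enter k => exact absurd (by simp [adj]) (h2 (.leave k))
  | leave k =>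
    obtain ⟨r, ⟨k', hr⟩ | hr⟩ := hk k
    · exact absurd (by simpa [adj] using hr) (h2 (.enter k'))
    · exact absurd (by simpa [adj] using hr) (h2 (.rcv r))
  | rcv r => exact absurd (by simp [adj]) (h2 (.sink r))
  | sink r =>
    cases u with
    | rcv r' =>
      obtain rfl : r' = r := by simpa [adj] using h1
      exact ⟨r', rfl⟩
    | _ => simp [adj] at h1

/-! ### A non-linear network code over an alphabet of size four -/

/-- The exchange of the two binary digits. -/
def swapBits : Fin 4 → Fin 4 := ![0, 2, 1, 3]

/-- The symbols of the coding edges. The Fano part uses the addition of `(ℤ/2)²`, the non-Fano part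
that of `ℤ/4`, with the digits of `c` exchanged in the second block. -/
def symbol (v : Msg → Fin 4) : Coder → Fin 4
  | .w => v .a ^^^ v .b
  | .x => v .b ^^^ v .c
  | .y => v .a ^^^ (v .b ^^^ v .c)
  | .z => (v .a ^^^ v .b) ^^^ (v .b ^^^ v .c)
  | .pabc => v .a + v .b + v .c
  | .pab => v .a + v .b
  | .pac => v .a + v .c
  | .pbc => v .b + v .c
  | .qcde => swapBits (v .c) + v .d + v .e
  | .qde => v .d + v .e
  | .qcd => swapBits (v .c) + v .d
  | .qce => swapBits (v .c) + v .e

theorem symbol_determined (k : Coder) (v v' : Msg → Fin 4) (h : ∀ m ∈ k.msgs, v m = v' m)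
    (h' : ∀ k' ∈ k.coders, symbol v k' = symbol v' k') : symbol v k = symbol v' k := by
  cases k <;> simp_all [Coder.msgs, Coder.coders, symbol]

theorem swapBits_injective : Function.Injective swapBits := by decide

/-- Doubling mod 4 retains exactly the low binary digit; after the swap, it retains the high one. -/
theorem eq_of_double_eq : ∀ i j : Fin 4, i + i = j + j →
    swapBits i + swapBits i = swapBits j + swapBits j → i = j := by decide

open Fin.CommRing in
theorem demand_determined (r : Receiver) (v v' : Msg → Fin 4) (h : ∀ m ∈ r.msgs, v m = v' m)
    (h' : ∀ k ∈ r.coders, symbol v k = symbol v' k) : v r.demand = v' r.demand := by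
  have x₁ : ∀ a b c : Fin 4, (a ^^^ b) ^^^ (a ^^^ (b ^^^ c)) = c := by decide
  have x₂ : ∀ a b c : Fin 4, (a ^^^ (b ^^^ c)) ^^^ ((a ^^^ b) ^^^ (b ^^^ c)) = b := by decide
  have x₃ : ∀ a b c : Fin 4, ((a ^^^ b) ^^^ (b ^^^ c)) ^^^ c = a := by decide
  cases r <;>
    simp only [Receiver.coders, Receiver.msgs, Finset.mem_insert, Finset.mem_singleton,
      forall_eq_or_imp, forall_eq, symbol, Finset.notMem_empty] at h h' <;>
    simp only [Receiver.demand]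
  · rw [← x₁ (v .a) (v .b) (v .c), h'.1, h'.2, x₁]
  · rw [← x₂ (v .a) (v .b) (v .c), h'.1, h'.2, x₂]
  · rw [← x₃ (v .a) (v .b) (v .c), h', h, x₃]
  · linear_combination h'.1 - h'.2
  · linear_combination h'.1 - h'.2
  · linear_combination h'.1 - h'.2
  · exact swapBits_injective (by linear_combination h'.1 - h'.2)
  · linear_combination h'.1 - h'.2
  · linear_combination h'.1 - h'.2
  · obtain ⟨h₁, h₂, h₃, h₄, h₅, h₆⟩ := h'
    -- (a + c) + (b + c) - (a + b) = 2c, and likewise for the second block with the swapped c.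
    exact eq_of_double_eq _ _ (by linear_combination h₂ + h₃ - h₁)
      (by linear_combination h₅ + h₆ - h₄)

/-- The symbol that is sent along the edges that leave a node. -/
def nodeSymbol (v : Msg → Fin 4) : Node → Fin 4
  | .src m => v m
  | .hub m => v m
  | .enter k => symbol v k
  | .leave k => symbol v k
  | .rcv r => v r.demand
  | .sink _ => 0

theorem nodeSymbol_determined {u w : Node} (he : (u, w) ∈ edges) (hs : ∀ m, u ≠ .src m)
    (v v' : Msg → Fin 4) (h : ∀ t, (t, u) ∈ edges → nodeSymbol v t = nodeSymbol v' t) :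
    nodeSymbol v u = nodeSymbol v' u := by
  cases u with
  | src m => exact absurd rfl (hs m)
  | hub m => exact h (.src m) (by simp [mem_edges, adj])
  | enter k =>
    exact symbol_determined k v v'
      (fun m hm => h (.hub m) (by simpa [mem_edges, adj] using hm))
      fun k' hk' => h (.leave k') (by simpa [mem_edges, adj] using hk')
  | leave k => exact h (.enter k) (by simp [mem_edges, adj])
  | rcv r =>
    exact demand_determined r v v'
      (fun m hm => h (.hub m) (by simpa [mem_edges, adj] using hm))
      fun k hk => h (.leave k) (by simpa [mem_edges, adj] using hk)
  | sink r => cases w <;> simp [mem_edges, adj] at he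

/-- The code over four letters is applied to each of the `n` coordinates separately. -/
theorem exists_isIndexCode (n : ℕ) :
    ∃ f, network.indexInstance.IsIndexCode (Fin 4) n (n * Nat.card network.E) f := by
  refine network.exists_isIndexCode_of_networkCode n
    (fun e v j => nodeSymbol (fun m => v (inputEdge m) j) e.1.1) ?_ ?_ ?_
  · intro s v
    obtain ⟨m, rfl⟩ := inputEdge_surjective s
    rfl
  · rintro ⟨⟨u, w⟩, he⟩ hs v v' h
    funext j
    refine nodeSymbol_determined he (fun m hm => ?_) _ _
      fun t ht => congrFun (h ⟨(t, u), ht⟩ rfl) j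
    subst hm
    have he' := (mem_edges _ _).1 he
    cases w with
    | hub m' =>
      obtain rfl : m = m' := by simpa [adj] using he'
      exact hs (input_mem m)
    | _ => simp [adj] at he'
  · intro t v
    obtain ⟨r, rfl⟩ := outputEdge_surjective t
    rfl

/-! ### No linear network code in characteristic two -/

/-- A linear index code with one block for each edge gives linear codes on the coding edges. -/
theorem exists_linear_symbols {F : Type*} [Field F] {n : ℕ}
    {f : (network.Message → Fin n → F) →ₗ[F] (Fin (n * Nat.card network.E) → F)}
    (hf : network.indexInstance.IsLinearIndexCode F n _ f) :
    ∃ P : Coder → (Msg → Fin n → F) →ₗ[F] (Fin n → F),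
      (∀ k v, k.coders = ∅ → (∀ m ∈ k.msgs, v m = 0) → P k v = 0) ∧
      ∀ (r : Receiver) v, r.msgs = ∅ → (∀ k ∈ r.coders, P k v = 0) → v r.demand = 0 := by
  obtain ⟨g, hgx, hg⟩ := network.exists_linear_networkCode hf
  have hbij : Function.Bijective inputEdge :=
    ⟨fun m m' h => Node.src.inj (congrArg (fun s : inputEdges network.E => s.1.1) h),
      inputEdge_surjective⟩
  let ε := Equiv.ofBijective inputEdge hbij
  let G := g ∘ₗ LinearMap.funLeft F (Fin n → F) ε.symm
  have hGx : ∀ v m, G v (network.x (inputEdge m)) = v m := fun v m => by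
    have : ε.symm (inputEdge m) = m := ε.symm_apply_apply m
    simp [G, hgx, LinearMap.funLeft_apply, this]
  have hG : ∀ v ρ, network.IsClient ρ → (∀ i ∈ ρ.2, G v i = 0) → G v ρ.1 = 0 :=
    fun v => hg _
  -- Zeros propagate from all parents to an edge that is not an input edge; the two claims below
  -- follow by walking back along edges.
  have edge : ∀ v (u w : Node) (h : (u, w) ∈ network.E), (∀ m, u ≠ .src m) →
      (∀ t (ht : (t, u) ∈ network.E), G v (network.y ⟨(t, u), ht⟩) = 0) →
      G v (network.y ⟨(u, w), h⟩) = 0 := by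
    intro v u w h hs ht
    refine hG v _ (.r₃ ⟨(u, w), h⟩ fun hin => ?_) ?_
    · obtain ⟨m, hm⟩ := inputEdge_surjective ⟨_, hin⟩
      exact hs m (congrArg (fun s : inputEdges network.E => s.1.1) hm).symm
    · rintro _ ⟨⟨⟨t, u'⟩, ht'⟩, rfl, rfl⟩
      exact ht t ht'
  have hk : ∀ k : Coder, (Node.enter k, Node.leave k) ∈ network.E := fun k =>
    (mem_edges _ _).2 (by simp [adj])
  refine ⟨fun k => LinearMap.proj (network.y ⟨_, hk k⟩) ∘ₗ G, fun k v hk' hv => ?_,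
    fun r v hr hv => ?_⟩
  · refine edge v _ _ _ (by simp) fun t ht => ?_
    have ht' := (mem_edges _ _).1 ht
    cases t with
    | hub m =>
      have hm : m ∈ k.msgs := by simpa [adj] using ht'
      refine edge v _ _ _ (by simp) fun t ht => ?_
      have ht' := (mem_edges _ _).1 ht
      cases t with
      | src m' =>
        obtain rfl : m' = m := by simpa [adj] using ht'
        refine hG v _ (.r₂ (inputEdge m')) ?_
        rintro _ rfl
        exact (hGx v m').trans (hv m' hm)
      | _ => simp [adj] at ht'
    | leave k' => simp [adj, hk'] at ht'
    | _ => simp [adj] at ht'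
  · rw [← hGx v r.demand]
    refine hG v _ (.r₄ (outputEdge r)) ?_
    rintro _ rfl
    refine edge v _ _ _ (by simp) fun t ht => ?_
    have ht' := (mem_edges _ _).1 ht
    cases t with
    | hub m => simp [adj, hr] at ht'
    | leave k =>
      have hkr : k ∈ r.coders := by simpa [adj] using ht'
      refine edge v _ _ _ (by simp) fun t ht => ?_
      have ht' := (mem_edges _ _).1 ht
      cases t with
      | enter k' =>
        obtain rfl : k' = k := by simpa [adj] using ht'
        exact hv k' hkr
      | _ => simp [adj] at ht'
    | _ => simp [adj] at ht'

/-- The assignment of given values to the five messages. -/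
def assign {W : Type*} (a b c d e : W) : Msg → W
  | .a => a
  | .b => b
  | .c => c
  | .d => d
  | .e => e

/-- Over a finite field of characteristic two, the non-Fano part has no linear network code. -/
theorem not_exists_linear_symbols {F W : Type*} [Field F] [CharP F 2] [AddCommGroup W] [Module F W]
    [Finite W] [Nontrivial W] (P : Coder → (Msg → W) →ₗ[F] W)
    (hP : ∀ k v, k.coders = ∅ → (∀ m ∈ k.msgs, v m = 0) → P k v = 0)
    (hR : ∀ (r : Receiver) v, r.msgs = ∅ → (∀ k ∈ r.coders, P k v = 0) → v r.demand = 0) : False := by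
  let Q : Coder → Msg → W →+ W := fun k m => (P k ∘ₗ LinearMap.single F _ m).toAddMonoidHom
  -- Subtracting from `v` its components at the messages of `k` leaves a vector that `P k` kills.
  have hQ : ∀ k v, k.coders = ∅ → P k v = ∑ m ∈ k.msgs, Q k m (v m) := by
    intro k v hk
    have h : P k (v - ∑ m ∈ k.msgs, Pi.single m (v m)) = 0 := by
      refine hP k _ hk fun m hm => ?_
      rw [Pi.sub_apply, Finset.sum_apply, Finset.sum_eq_single_of_mem m hm]
      · simp
      · intro m' _ hm'
        exact Pi.single_eq_of_ne hm'.symm _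
    rw [map_sub, sub_eq_zero, map_sum] at h
    exact h
  have hW : ∀ v : W, v + v = 0 := fun v => by
    rw [← two_smul F v, CharTwo.two_eq_zero, zero_smul]
  have three : ∀ k i j l, k.coders = ∅ → k.msgs = {i, j, l} → i ∉ ({j, l} : Finset Msg) →
      j ∉ ({l} : Finset Msg) → ∀ v, P k v = Q k i (v i) + (Q k j (v j) + Q k l (v l)) :=
    fun k i j l hk hm hi hj v => by
      rw [hQ k v hk, hm, Finset.sum_insert hi, Finset.sum_insert hj, Finset.sum_singleton]
  have two : ∀ k i j, k.coders = ∅ → k.msgs = {i, j} → i ∉ ({j} : Finset Msg) →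
      ∀ v, P k v = Q k i (v i) + Q k j (v j) := fun k i j hk hm hi v => by
    rw [hQ k v hk, hm, Finset.sum_insert hi, Finset.sum_singleton]
  have pabc := three .pabc .a .b .c rfl rfl (by decide) (by decide)
  have pab := two .pab .a .b rfl rfl (by decide)
  have pac := two .pac .a .c rfl rfl (by decide)
  have pbc := two .pbc .b .c rfl rfl (by decide)
  have qcde := three .qcde .c .d .e rfl rfl (by decide) (by decide)
  have qde := two .qde .d .e rfl rfl (by decide)
  have qcd := two .qcd .c .d rfl rfl (by decide)
  have qce := two .qce .c .e rfl rfl (by decide)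
  -- The same nonzero `c` serves both blocks, which otherwise share no message, so all six inputs of
  -- the last receiver can vanish together.
  obtain ⟨c, hc⟩ := exists_ne (0 : W)
  obtain ⟨a, b, h₁, h₂, h₃⟩ := exists_pairwise_codes_eq_zero hW
    (Q .pabc .a) (Q .pabc .b) (Q .pabc .c) (Q .pab .a) (Q .pab .b) (Q .pac .a) (Q .pac .c)
    (Q .pbc .b) (Q .pbc .c)
    (fun a b c h h' => hR .p₁ (assign a b c 0 0) rfl (by
      simp [Receiver.coders, pabc, pab, assign, ← add_assoc, h, h']))
    (fun a b c h h' => hR .p₂ (assign a b c 0 0) rfl (by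
      simp [Receiver.coders, pabc, pac, assign, ← add_assoc, h, h']))
    (fun a b c h h' => hR .p₃ (assign a b c 0 0) rfl (by
      simp [Receiver.coders, pabc, pbc, assign, ← add_assoc, h, h'])) c
  obtain ⟨d, e, h₄, h₅, h₆⟩ := exists_pairwise_codes_eq_zero hW
    (Q .qcde .d) (Q .qcde .e) (Q .qcde .c) (Q .qde .d) (Q .qde .e) (Q .qcd .d) (Q .qcd .c)
    (Q .qce .e) (Q .qce .c)
    (fun d e c h h' => hR .q₁ (assign 0 0 c d e) rfl (by
      rw [add_comm] at h
      simp [Receiver.coders, qcde, qde, assign, h, h']))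
    (fun d e c h h' => hR .q₂ (assign 0 0 c d e) rfl (by
      rw [add_comm] at h h'
      simp [Receiver.coders, qcde, qcd, assign, h, h']))
    (fun d e c h h' => hR .q₃ (assign 0 0 c d e) rfl (by
      rw [add_comm] at h h'
      simp [Receiver.coders, qcde, qce, assign, h, h'])) c
  rw [add_comm] at h₅ h₆
  exact hc (hR .last (assign a b c d e) rfl (by
    simp [Receiver.coders, pab, pac, pbc, qde, qcd, qce, assign, h₁, h₂, h₃, h₄, h₅, h₆]))

/-! ### Optimal lengths and rates -/

theorem lt_of_isLinearIndexCode {F : Type*} [Field F] [Finite F] [CharP F 2] {n c : ℕ} (hn : 0 < n)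
    {f : (network.Message → Fin n → F) →ₗ[F] (Fin c → F)}
    (hf : network.indexInstance.IsLinearIndexCode F n c f) : n * Nat.card network.E < c := by
  refine lt_of_le_of_ne
    ((Nat.mul_le_mul_left n network.card_edges_le_mu).trans hf.isIndexCode.mul_mu_le) ?_
  rintro rfl
  have : Nonempty (Fin n) := ⟨⟨0, hn⟩⟩
  obtain ⟨P, hP, hR⟩ := exists_linear_symbols hf
  exact not_exists_linear_symbols P hP hR

/-- The upper bound needs no inspection of the clients: a code of block length 1 and length |E|
exists, and `μ` is at most its length. -/
theorem mu_eq_card_edges : network.indexInstance.mu = Nat.card network.E := by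
  obtain ⟨f, hf⟩ := exists_isIndexCode 1
  refine le_antisymm ?_ network.card_edges_le_mu
  simpa using hf.mul_mu_le

theorem rate_eq_mu {n : ℕ} (hn : 0 < n) :
    network.indexInstance.rate n 4 = (network.indexInstance.mu : ℚ) := by
  have h : network.indexInstance.minLength n 4 = n * network.indexInstance.mu := by
    refine le_antisymm ?_ ?_
    · rw [mu_eq_card_edges]
      exact Nat.sInf_le (exists_isIndexCode n)
    · obtain ⟨f, hf⟩ := Nat.sInf_mem (s := {c | ∃ f, network.indexInstance.IsIndexCode
        (Fin 4) n c f}) ⟨_, exists_isIndexCode n⟩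
      exact hf.mul_mu_le
  have hn' : (n : ℚ) ≠ 0 := by exact_mod_cast hn.ne'
  rw [Instance.rate, h, Nat.cast_mul, mul_div_cancel_left₀ _ hn']

theorem mu_lt_linearRate {n : ℕ} (hn : 0 < n) (F : Type*) [Field F] [Finite F] [CharP F 2] :
    (network.indexInstance.mu : ℚ) < network.indexInstance.linearRate n F := by
  -- The infimum is attained because some linear code exists; over an empty set it would be 0.
  obtain ⟨f, hf⟩ := Nat.sInf_mem (s := {c | ∃ f, network.indexInstance.IsLinearIndexCode F n c f})
    (network.indexInstance.exists_isLinearIndexCode F n)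
  have h : n * network.indexInstance.mu < network.indexInstance.minLinearLength n F := by
    rw [mu_eq_card_edges]
    exact lt_of_isLinearIndexCode hn hf
  have hn' : (0 : ℚ) < n := by exact_mod_cast hn
  rw [Instance.linearRate, lt_div_iff₀ hn', mul_comm]
  exact_mod_cast h

end DFZ

end IndexCoding

theorem corollary17 (F : Type*) [Field F] [Fintype F] (hF : Fintype.card F = 4) :
    IndexCoding.DFZ.network.indexInstance.rate 2 4 =
        (IndexCoding.DFZ.network.indexInstance.mu : ℚ) ∧
      (IndexCoding.DFZ.network.indexInstance.mu : ℚ) <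
        IndexCoding.DFZ.network.indexInstance.linearRate 2 F := by
  have h2 : (2 : F) = 0 := by
    have h := Nat.cast_card_eq_zero F
    rw [hF] at h
    have h' : (2 : F) * 2 = 0 := by
      rw [← h]
      norm_num
    exact mul_self_eq_zero.1 h'
  have : CharP F 2 := CharTwo.of_one_ne_zero_of_two_eq_zero one_ne_zero h2
  exact ⟨IndexCoding.DFZ.rate_eq_mu two_pos, IndexCoding.DFZ.mu_lt_linearRate two_pos F⟩
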